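/- Let $G$ be a connected simple graph of order $n \ge 5$. Its normalized Laplacian is the real symmetric matrix $\mathcal L(G) = [l_{uv}]$ with $l_{uu}=1$, $l_{uv} = -1/\sqrt{d_u d_v}$ if $u$ and $v$ are adjacent, and $l_{uv}=0$ otherwise, where $d_u$ is the degree of $u$; let $\rho_1(G) \ge \rho_2(G) \ge \cdots \ge \rho_n(G) = 0$ be its eigenvalues, listed with multiplicity. Assume that some eigenvalue of $\mathcal L(G)$ has multiplicity exactly $n-3$. Then the following are equivalent: (a) $G$ contains the path $P_4$ on four vertices as an induced subgraph, $\rho_{n-1}(G) \ne 1$, and the independence number and the diameter of $G$ are both equal to $2$; (b) $G$ is isomorphic to the cycle $C_5$. -/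

import Mathlib

/-- The normalized Laplacian matrix of a finite simple graph: the entry at `(u, v)` is `1` if
`u = v`, it is `-1 / √(d_u d_v)` if `u` and `v` are adjacent, and it is `0` otherwise. (For a graph
without isolated vertices this is `D^(-1/2) (D - A) D^(-1/2)`.) -/
noncomputable def SimpleGraph.normLapMatrix {V : Type*} [Fintype V] [DecidableEq V]
    (G : SimpleGraph V) [DecidableRel G.Adj] : Matrix V V ℝ :=
  Matrix.of fun u v =>
    if u = v then 1
    else if G.Adj u v then -1 / Real.sqrt ((G.degree u : ℝ) * (G.degree v : ℝ))
    else 0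

theorem SimpleGraph.isHermitian_normLapMatrix {V : Type*} [Fintype V] [DecidableEq V]
    (G : SimpleGraph V) [DecidableRel G.Adj] : G.normLapMatrix.IsHermitian := by
  ext u v
  simp only [SimpleGraph.normLapMatrix, Matrix.conjTranspose_apply, Matrix.of_apply, star_trivial,
    eq_comm (a := v) (b := u), G.adj_comm v u, mul_comm (G.degree v : ℝ)]

/-- The `i`-th largest normalized Laplacian eigenvalue `ρ_i(G)`, for `1 ≤ i ≤ n` where `n` is the
order of `G`: the eigenvalues are listed with multiplicity, `ρ_1(G) ≥ ρ_2(G) ≥ ⋯ ≥ ρ_n(G)`. -/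
noncomputable def SimpleGraph.normLapEigenvalue {V : Type*} [Fintype V] [DecidableEq V]
    (G : SimpleGraph V) [DecidableRel G.Adj] (i : ℕ) (h1 : 1 ≤ i) (h2 : i ≤ Fintype.card V) : ℝ :=
  G.isHermitian_normLapMatrix.eigenvalues₀ ⟨i - 1, by omega⟩

/-- The multiplicity of the real number `θ` as a normalized Laplacian eigenvalue: the dimension of
its eigenspace (the matrix is real symmetric). It is `0` if `θ` is not an eigenvalue. -/
noncomputable def SimpleGraph.normLapMultiplicity {V : Type*} [Fintype V] [DecidableEq V]
    (G : SimpleGraph V) [DecidableRel G.Adj] (θ : ℝ) : ℕ :=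
  Module.finrank ℝ (Module.End.eigenspace (Matrix.toLin' G.normLapMatrix) θ)

/-- `G` is connected, has order `n ≥ 5`, and some normalized Laplacian eigenvalue of `G` has
multiplicity exactly `n - 3`. -/
structure SimpleGraph.MemGnSubThree {V : Type*} [Fintype V] [DecidableEq V]
    (G : SimpleGraph V) [DecidableRel G.Adj] : Prop where
  connected : G.Connected
  five_le_card : 5 ≤ Fintype.card V
  exists_multiplicity : ∃ θ : ℝ, G.normLapMultiplicity θ = Fintype.card V - 3

/-!
A vector `x` satisfies `𝓛 x = θ x` exactly when `D^(-1/2) x` is killed by `B = A + μ D`, where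
`μ = θ - 1`. So an eigenvalue of multiplicity `n - 3` means that `B` has rank three
(`rank_adjAddDegMatrix`). On an induced path `a b c d` the rows `a, b, c` and columns `b, c, d` of
`B` form a triangular matrix with ones on the diagonal; hence the entries at `b, c, d` determine
every vector of the range of `B`. Write `s v = μ deg v` for the diagonal entries. This has two
consequences.

* The principal block of `B` at the path has a kernel vector, with no entry zero, which all other
  rows of `B` kill as well (`HasRankThree.exists_kernel`). Each way in which an outer vertex can be
  attached to the path thus costs one equation between the numbers `s a, s b, s c, s d`.
* Two vertices with the same closed neighbours on the path have equal columns in `B`, and then `s`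
  is `1` at both (`HasRankThree.scaledDegree_eq_one`).

Independence number two leaves eight closed types of vertices at the path, and diameter two makes
one of the types `{a, d}`, `{a, b, d}`, `{a, c, d}`, `{a, b, c, d}` occur outside the path. The
degrees of `a, b, c, d` are sums of class sizes, and a class can have a size other than `1` only if
`s = 1` on it. Together with the kernel equations this refutes all types but `{a, d}`
(`not_closedType_abd`, `not_closedType_ad_abcd`, `not_closedType_abcd`). In the remaining case `G`
is a five-cycle in which vertices are replaced by cliques. The kernel equations of its rotations are
`s a * s b = 1 + s d` and the like; a clique with more than one vertex would make the square root of
two a quotient of two degrees (`scaledDegree_ne_one_of_five_cycle`), so `G` is the five-cycle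
itself.
An induced `P₄` always forces `ρ_{n-1} < 1` by interlacing, so the condition on `ρ_{n-1}` is only
something to verify for the five-cycle (`normLapEigenvalue_ne_one_of_iso`).
-/

/-! ### The matrix `A + μ D` -/

namespace SimpleGraph

variable {V : Type*} [Fintype V] [DecidableEq V] (G : SimpleGraph V) [DecidableRel G.Adj]

/-- The matrix `A + μ D`, where `A` is the adjacency matrix and `D` the diagonal degree matrix. -/
def adjAddDegMatrix (μ : ℝ) : Matrix V V ℝ :=
  Matrix.of fun u v => if u = v then μ * G.degree u else if G.Adj u v then 1 else 0

variable {G}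

theorem adjAddDegMatrix_self (μ : ℝ) (v : V) :
    G.adjAddDegMatrix μ v v = μ * G.degree v := by simp [adjAddDegMatrix]

theorem adjAddDegMatrix_of_adj (μ : ℝ) {u v : V} (h : G.Adj u v) :
    G.adjAddDegMatrix μ u v = 1 := by simp [adjAddDegMatrix, h, h.ne]

theorem adjAddDegMatrix_of_not_adj (μ : ℝ) {u v : V} (hne : u ≠ v) (h : ¬ G.Adj u v) :
    G.adjAddDegMatrix μ u v = 0 := by simp [adjAddDegMatrix, h, hne]

theorem adjAddDegMatrix_comm (μ : ℝ) (u v : V) :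
    G.adjAddDegMatrix μ u v = G.adjAddDegMatrix μ v u := by
  by_cases h : u = v
  · rw [h]
  · simp [adjAddDegMatrix, h, Ne.symm h, G.adj_comm u v]

/-- `D^(1/2) (θ - 𝓛) D^(1/2) = A + (θ - 1) D`, so the two have the same rank. -/
theorem rank_adjAddDegMatrix (hd : ∀ v, 0 < G.degree v) {θ : ℝ} {m : ℕ}
    (hθ : G.normLapMultiplicity θ + m = Fintype.card V) :
    (G.adjAddDegMatrix (θ - 1)).rank = m := by
  set S : Matrix V V ℝ := Matrix.diagonal fun v => Real.sqrt (G.degree v) with hS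
  have hpos : ∀ v, 0 < Real.sqrt (G.degree v) := fun v =>
    Real.sqrt_pos.2 (by exact_mod_cast hd v)
  have hSu : IsUnit S.det := by
    rw [hS, Matrix.det_diagonal, isUnit_iff_ne_zero]
    exact Finset.prod_ne_zero_iff.2 fun v _ => (hpos v).ne'
  have hfac : G.adjAddDegMatrix (θ - 1) = S * (θ • (1 : Matrix V V ℝ) - G.normLapMatrix) * S := by
    ext u v
    have h1 : Real.sqrt (G.degree u) * Real.sqrt (G.degree u) = G.degree u :=
      Real.mul_self_sqrt (by positivity)
    have hu := (hpos u).ne'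
    have hv := (hpos v).ne'
    rw [hS, Matrix.mul_diagonal, Matrix.diagonal_mul]
    by_cases huv : u = v
    · subst huv
      simp [adjAddDegMatrix, normLapMatrix]
      linear_combination (1 - θ) * h1
    · by_cases ha : G.Adj u v
      · simp [adjAddDegMatrix, normLapMatrix, huv, ha]
        field_simp
      · simp [adjAddDegMatrix, normLapMatrix, huv, ha]
  rw [hfac, Matrix.rank_mul_eq_left_of_isUnit_det _ _ hSu,
    Matrix.rank_mul_eq_right_of_isUnit_det _ _ hSu]
  have hker : Module.End.eigenspace (Matrix.toLin' G.normLapMatrix) θ =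
      LinearMap.ker (θ • (1 : Matrix V V ℝ) - G.normLapMatrix).mulVecLin := by
    ext x
    simp [sub_eq_zero, eq_comm]
  have hrn := LinearMap.finrank_range_add_finrank_ker
    (θ • (1 : Matrix V V ℝ) - G.normLapMatrix).mulVecLin
  rw [normLapMultiplicity, hker] at hθ
  rw [Module.finrank_fintype_fun_eq_card] at hrn
  rw [Matrix.rank]
  omega

/-- If some images under a matrix of rank three form an invertible triangular matrix in the
coordinates `b`, `c`, `d`, then these coordinates determine every vector of the range. -/
theorem _root_.Matrix.mulVec_eq_zero_of_rank_eq_three {M : Matrix V V ℝ} (hM : M.rank = 3)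
    {a b c b' c' d' : V} (h1 : M b' a ≠ 0) (h2 : M c' a = 0) (h3 : M d' a = 0)
    (h4 : M c' b ≠ 0) (h5 : M d' b = 0) (h6 : M d' c ≠ 0)
    {x : V → ℝ} (hb : (M.mulVec x) b' = 0) (hc : (M.mulVec x) c' = 0)
    (hd : (M.mulVec x) d' = 0) : M.mulVec x = 0 := by
  let P : (V → ℝ) →ₗ[ℝ] (Fin 3 → ℝ) := LinearMap.funLeft ℝ ℝ ![b', c', d']
  let T : LinearMap.range M.mulVecLin →ₗ[ℝ] (Fin 3 → ℝ) := P ∘ₗ Submodule.subtype _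
  have hsurj : Function.Surjective T := by
    intro t
    let z := t 2 / M d' c
    let y := (t 1 - z * M c' c) / M c' b
    let w := (t 0 - z * M b' c - y * M b' b) / M b' a
    refine ⟨⟨M.mulVec (w • Pi.single a 1 + y • Pi.single b 1 + z • Pi.single c 1), _, rfl⟩, ?_⟩
    ext i
    fin_cases i <;>
      simp [T, P, LinearMap.funLeft_apply, Matrix.mulVec_add, Matrix.mulVec_smul, h2, h3, h5]
    · simp only [w]; field_simp; ring
    · simp only [y]; field_simp; ring
    · simp only [z]; field_simp
  have hinj : Function.Injective T :=
    (LinearMap.injective_iff_surjective_of_finrank_eq_finrank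
      (by rw [Module.finrank_fin_fun]; exact hM)).2 hsurj
  have hx : (⟨M.mulVec x, x, rfl⟩ : LinearMap.range M.mulVecLin) = 0 := by
    apply hinj
    ext i
    fin_cases i <;> simp [T, P, LinearMap.funLeft_apply, hb, hc, hd]
  exact congrArg Subtype.val hx

end SimpleGraph

/-! ### Induced paths and closed types -/

namespace SimpleGraph

variable {V : Type*} {G : SimpleGraph V}

/-- The vertices `a`, `b`, `c`, `d`, in this order, induce a path on four vertices. (They are then
automatically distinct.) -/
structure IsInducedPathFour (G : SimpleGraph V) (a b c d : V) : Prop where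
  ab : G.Adj a b
  bc : G.Adj b c
  cd : G.Adj c d
  not_ac : ¬ G.Adj a c
  not_ad : ¬ G.Adj a d
  not_bd : ¬ G.Adj b d

namespace IsInducedPathFour

variable {a b c d : V}

theorem reverse (P : G.IsInducedPathFour a b c d) : G.IsInducedPathFour d c b a :=
  ⟨P.cd.symm, P.bc.symm, P.ab.symm, fun h => P.not_bd h.symm, fun h => P.not_ad h.symm,
    fun h => P.not_ac h.symm⟩

theorem ne_ac (P : G.IsInducedPathFour a b c d) : a ≠ c := by
  rintro rfl; exact P.not_ad P.cd

theorem ne_ad (P : G.IsInducedPathFour a b c d) : a ≠ d := by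
  rintro rfl; exact P.not_bd P.ab.symm

theorem ne_bd (P : G.IsInducedPathFour a b c d) : b ≠ d := P.reverse.ne_ac.symm

end IsInducedPathFour

variable [DecidableEq V] [DecidableRel G.Adj]

/-- The trace of the closed neighbourhood of `u` on `{a, b, c, d}`: for each of the four vertices,
whether it is equal or adjacent to `u`. -/
def closedType (G : SimpleGraph V) [DecidableRel G.Adj] (a b c d u : V) :
    Bool × Bool × Bool × Bool :=
  (decide (u = a ∨ G.Adj u a), decide (u = b ∨ G.Adj u b), decide (u = c ∨ G.Adj u c),
    decide (u = d ∨ G.Adj u d))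

namespace IsInducedPathFour

variable {a b c d e f : V}

theorem closedType_fst (P : G.IsInducedPathFour a b c d) :
    G.closedType a b c d a = (true, true, false, false) := by
  simp [closedType, P.ab, P.not_ac, P.not_ad, P.ne_ac, P.ne_ad]

theorem closedType_snd (P : G.IsInducedPathFour a b c d) :
    G.closedType a b c d b = (true, true, true, false) := by
  simp [closedType, P.ab.symm, P.bc, P.not_bd, P.ne_bd]

theorem closedType_thd (P : G.IsInducedPathFour a b c d) :
    G.closedType a b c d c = (false, true, true, true) := by
  simp [closedType, P.cd, P.bc.symm, P.ne_ac.symm, mt G.adj_symm P.not_ac]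

theorem closedType_fth (P : G.IsInducedPathFour a b c d) :
    G.closedType a b c d d = (false, false, true, true) := by
  simp [closedType, P.cd.symm, P.ne_ad.symm, P.ne_bd.symm, mt G.adj_symm P.not_ad,
    mt G.adj_symm P.not_bd]

/-- A vertex of closed type `{a, d}` closes the path to an induced five-cycle. -/
theorem five_cycle (P : G.IsInducedPathFour a b c d)
    (he : G.closedType a b c d e = (true, false, false, true)) :
    G.Adj e a ∧ ¬ G.Adj e b ∧ ¬ G.Adj e c ∧ G.Adj e d ∧ e ≠ b ∧ e ≠ c := by
  have hea : e ≠ a := by rintro rfl; simp [P.closedType_fst] at he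
  have heb : e ≠ b := by rintro rfl; simp [P.closedType_snd] at he
  have hec : e ≠ c := by rintro rfl; simp [P.closedType_thd] at he
  have hed : e ≠ d := by rintro rfl; simp [P.closedType_fth] at he
  simp only [closedType, hea, heb, hec, hed, false_or, Prod.mk.injEq, decide_eq_true_eq,
    decide_eq_false_iff_not] at he
  exact ⟨he.1, he.2.1, he.2.2.1, he.2.2.2, heb, hec⟩

/-- An induced five-cycle can be rotated. -/
theorem rotate (P : G.IsInducedPathFour a b c d)
    (he : G.closedType a b c d e = (true, false, false, true)) :
    G.IsInducedPathFour b c d e ∧ G.closedType b c d e a = (true, false, false, true) := by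
  obtain ⟨ea, eb, ec, ed, -, -⟩ := P.five_cycle he
  refine ⟨⟨P.bc, P.cd, ed.symm, P.not_bd, mt G.adj_symm eb, mt G.adj_symm ec⟩, ?_⟩
  simp [closedType, P.ab, ea.symm, P.ne_ac, P.not_ac, P.ne_ad, P.not_ad]

theorem dominating (P : G.IsInducedPathFour a b c d)
    (hf : G.closedType a b c d f = (true, true, true, true)) :
    f ≠ a ∧ f ≠ b ∧ f ≠ c ∧ f ≠ d ∧ G.Adj f a ∧ G.Adj f b ∧ G.Adj f c ∧ G.Adj f d := by
  have hfa : f ≠ a := by rintro rfl; simp [P.closedType_fst] at hf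
  have hfb : f ≠ b := by rintro rfl; simp [P.closedType_snd] at hf
  have hfc : f ≠ c := by rintro rfl; simp [P.closedType_thd] at hf
  have hfd : f ≠ d := by rintro rfl; simp [P.closedType_fth] at hf
  simp only [closedType, hfa, hfb, hfc, hfd, false_or, Prod.mk.injEq, decide_eq_true_eq] at hf
  exact ⟨hfa, hfb, hfc, hfd, hf.1, hf.2.1, hf.2.2.1, hf.2.2.2⟩

end IsInducedPathFour

variable [Fintype V]

/-- The degree of `v` scaled by `μ`, i.e. the diagonal entry at `v` of `A + μ D`. -/
def scaledDegree {V : Type*} [Fintype V] (G : SimpleGraph V) [DecidableRel G.Adj] (μ : ℝ)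
    (v : V) : ℝ :=
  μ * G.degree v

/-- `A + μ D` has rank three, there are no isolated vertices, and no three vertices are pairwise
nonadjacent. -/
structure HasRankThree (G : SimpleGraph V) [DecidableRel G.Adj] (μ : ℝ) : Prop where
  rank : (G.adjAddDegMatrix μ).rank = 3
  degree_pos : ∀ v, 0 < G.degree v
  adj_of_ne : ∀ u v w, u ≠ v → v ≠ w → u ≠ w → G.Adj u v ∨ G.Adj v w ∨ G.Adj u w

namespace HasRankThree

variable {μ : ℝ} {a b c d : V}

local notation "B" => adjAddDegMatrix G μ
local notation "s" => scaledDegree G μ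

/-- The coordinates of the vertices `b`, `c`, `d` of an induced path determine the vectors in the
range of `A + μ D`. -/
theorem mulVec_eq_zero (H : G.HasRankThree μ) (P : G.IsInducedPathFour a b c d) {x : V → ℝ}
    (hb : (Matrix.mulVec B x) b = 0) (hc : (Matrix.mulVec B x) c = 0)
    (hd : (Matrix.mulVec B x) d = 0) :
    Matrix.mulVec B x = 0 := by
  refine Matrix.mulVec_eq_zero_of_rank_eq_three H.rank (a := a) (b := b) (c := c) ?_ ?_ ?_ ?_ ?_ ?_
    hb hc hd
  · simp [adjAddDegMatrix_of_adj μ P.ab.symm]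
  · exact adjAddDegMatrix_of_not_adj μ P.ne_ac.symm fun h => P.not_ac h.symm
  · exact adjAddDegMatrix_of_not_adj μ P.ne_ad.symm fun h => P.not_ad h.symm
  · simp [adjAddDegMatrix_of_adj μ P.bc.symm]
  · exact adjAddDegMatrix_of_not_adj μ P.ne_bd.symm fun h => P.not_bd h.symm
  · simp [adjAddDegMatrix_of_adj μ P.cd.symm]

/-- A linear dependency between the columns of an induced path and one more vertex only has to be
checked in three rows. -/
theorem combination_eq_zero (H : G.HasRankThree μ) (P : G.IsInducedPathFour a b c d) (e : V)
    {y₁ y₂ y₃ y₄ y₅ : ℝ}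
    (hb : B b a * y₁ + B b b * y₂ + B b c * y₃ + B b d * y₄ + B b e * y₅ = 0)
    (hc : B c a * y₁ + B c b * y₂ + B c c * y₃ + B c d * y₄ + B c e * y₅ = 0)
    (hd : B d a * y₁ + B d b * y₂ + B d c * y₃ + B d d * y₄ + B d e * y₅ = 0) (v : V) :
    B v a * y₁ + B v b * y₂ + B v c * y₃ + B v d * y₄ + B v e * y₅ = 0 := by
  have key : ∀ w, (Matrix.mulVec B (y₁ • Pi.single a 1 + y₂ • Pi.single b 1 + y₃ • Pi.single c 1 +
      y₄ • Pi.single d 1 + y₅ • Pi.single e 1)) w =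
      B w a * y₁ + B w b * y₂ + B w c * y₃ + B w d * y₄ + B w e * y₅ := by
    intro w
    simp [Matrix.mulVec_add, Matrix.mulVec_smul]
    ring
  rw [← key, H.mulVec_eq_zero P (by rw [key, hb]) (by rw [key, hc]) (by rw [key, hd])]
  rfl

theorem column_eq (H : G.HasRankThree μ) (P : G.IsInducedPathFour a b c d) {u v : V}
    (hb : B b u = B b v) (hc : B c u = B c v) (hd : B d u = B d v) (w : V) : B w u = B w v := by
  have key : ∀ w, (Matrix.mulVec B (Pi.single u 1 - Pi.single v 1)) w = B w u - B w v := by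
    intro w
    simp [Matrix.mulVec_sub]
  rw [← sub_eq_zero, ← key, H.mulVec_eq_zero P (by rw [key, hb, sub_self])
    (by rw [key, hc, sub_self]) (by rw [key, hd, sub_self])]
  rfl

/-- The restriction of `A + μ D` to an induced path `a b c d` has a kernel vector, which, scaled to
be `1` at `a`, is `(1, -s a, -s d * t, t)`; it also kills all other rows of `A + μ D`. -/
theorem exists_kernel (H : G.HasRankThree μ) (P : G.IsInducedPathFour a b c d) :
    s a ≠ 0 ∧ s d ≠ 0 ∧ ∃ t, t ≠ 0 ∧ 1 - s a * s b = s d * t ∧ t * (1 - s c * s d) = s a ∧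
      ∀ v, v ≠ a → v ≠ b → v ≠ c → v ≠ d →
        (if G.Adj v a then 1 else 0) - (if G.Adj v b then s a else 0) -
        (if G.Adj v c then s d * t else 0) + (if G.Adj v d then t else 0) = 0 := by
  have eba := adjAddDegMatrix_of_adj μ P.ab.symm
  have ecb := adjAddDegMatrix_of_adj μ P.bc.symm
  have edc := adjAddDegMatrix_of_adj μ P.cd.symm
  have eab := adjAddDegMatrix_of_adj μ P.ab
  have ebc := adjAddDegMatrix_of_adj μ P.bc
  have ecd := adjAddDegMatrix_of_adj μ P.cd
  have eac := adjAddDegMatrix_of_not_adj μ P.ne_ac P.not_ac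
  have ead := adjAddDegMatrix_of_not_adj μ P.ne_ad P.not_ad
  have ebd := adjAddDegMatrix_of_not_adj μ P.ne_bd P.not_bd
  have eca := (adjAddDegMatrix_comm μ c a).trans eac
  have eda := (adjAddDegMatrix_comm μ d a).trans ead
  have edb := (adjAddDegMatrix_comm μ d b).trans ebd
  have eaa : B a a = s a := adjAddDegMatrix_self μ a
  have ebb : B b b = s b := adjAddDegMatrix_self μ b
  have ecc : B c c = s c := adjAddDegMatrix_self μ c
  have edd : B d d = s d := adjAddDegMatrix_self μ d
  -- The kernel vector scaled to be `1` at `d`: rows `d`, `c`, `b` determine its other entries.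
  have ker := fun v => H.combination_eq_zero P a (y₁ := s d - s b * (s c * s d - 1))
    (y₂ := s c * s d - 1) (y₃ := - s d) (y₄ := 1) (y₅ := 0)
    (by rw [eba, ebb, ebc, ebd]; ring) (by rw [eca, ecb, ecc, ecd]; ring)
    (by rw [eda, edb, edc, edd]; ring) v
  have hr := ker a
  rw [eaa, eab, eac, ead] at hr
  set y₁ := s d - s b * (s c * s d - 1) with hy₁
  have hd0 : s d ≠ 0 := by
    intro h
    have hμ : μ = 0 := by
      have hp : (G.degree d : ℝ) ≠ 0 := by exact_mod_cast (H.degree_pos d).ne'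
      simpa [scaledDegree, hp] using h
    have ha : s a = 0 := by simp [scaledDegree, hμ]
    rw [h, ha] at hr
    norm_num at hr
  have hy0 : y₁ ≠ 0 := by
    intro h
    have h2 : s c * s d - 1 = 0 := by rw [h] at hr; linarith
    rw [h2] at hy₁
    apply hd0
    linarith
  have ha0 : s a ≠ 0 := by
    intro h
    have h2 : s c * s d - 1 = 0 := by rw [h] at hr; linarith
    have hp : (G.degree a : ℝ) ≠ 0 := by exact_mod_cast (H.degree_pos a).ne'
    have hμ : μ = 0 := by simpa [scaledDegree, hp] using h
    exact hd0 (by simp [scaledDegree, hμ])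
  refine ⟨ha0, hd0, 1 / y₁, by positivity, ?_, ?_, ?_⟩
  · field_simp
    linear_combination hy₁ - s b * hr
  · field_simp
    linear_combination -hr
  · intro v hva hvb hvc hvd
    have hv := ker v
    have hB : ∀ x, v ≠ x → B v x = if G.Adj v x then 1 else 0 := by
      intro x hx; simp [adjAddDegMatrix, hx]
    rw [hB a hva, hB b hvb, hB c hvc, hB d hvd] at hv
    have h2 : s c * s d - 1 = - s a * y₁ := by linarith
    rw [h2] at hv
    have e1 : ∀ (p : Prop) [Decidable p] (z : ℝ),
        (if p then z else 0) = (if p then 1 else 0) * z := by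
      intro p _ z; split_ifs <;> simp
    rw [e1 (G.Adj v b) (s a), e1 (G.Adj v c) (s d * (1 / y₁)), e1 (G.Adj v d) (1 / y₁)]
    field_simp
    linear_combination hv

theorem scaledDegree_ne_zero (H : G.HasRankThree μ) (P : G.IsInducedPathFour a b c d) (v : V) :
    s v ≠ 0 := by
  have h := (H.exists_kernel P).1
  have hμ : μ ≠ 0 := by rintro rfl; simp [scaledDegree] at h
  have hp : (G.degree v : ℝ) ≠ 0 := by exact_mod_cast (H.degree_pos v).ne'
  exact mul_ne_zero hμ hp

end HasRankThree

/-- The number of vertices of a given closed type. -/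
def closedTypeCard (G : SimpleGraph V) [DecidableRel G.Adj] (a b c d : V)
    (t : Bool × Bool × Bool × Bool) : ℕ :=
  (Finset.univ.filter fun u => G.closedType a b c d u = t).card

namespace HasRankThree

variable {μ : ℝ} {a b c d : V}

local notation "B" => adjAddDegMatrix G μ
local notation "s" => scaledDegree G μ
local notation "τ" => closedType G a b c d

/-- The kernel relation of a vertex with the same closed neighbours on the path as a path vertex
`x`, compared with the row of `x` itself. -/
theorem scaledDegree_eq_one_of_mem (H : G.HasRankThree μ) (P : G.IsInducedPathFour a b c d)
    {u x : V} (hx : x = a ∨ x = b ∨ x = c ∨ x = d) (hux : u ≠ x) (h : τ u = τ x) : s x = 1 := by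
  have ta := P.closedType_fst
  have tb := P.closedType_snd
  have tc := P.closedType_thd
  have td := P.closedType_fth
  have hua : u ≠ a := by rintro rfl; rcases hx with rfl | rfl | rfl | rfl <;> simp_all
  have hub : u ≠ b := by rintro rfl; rcases hx with rfl | rfl | rfl | rfl <;> simp_all
  have huc : u ≠ c := by rintro rfl; rcases hx with rfl | rfl | rfl | rfl <;> simp_all
  have hud : u ≠ d := by rintro rfl; rcases hx with rfl | rfl | rfl | rfl <;> simp_all
  obtain ⟨ha, hd, t, ht, h1, h2, hk⟩ := H.exists_kernel P
  have hk := hk u hua hub huc hud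
  rcases hx with rfl | rfl | rfl | rfl
  · rw [ta] at h
    simp only [closedType, hua, hub, huc, hud, false_or, Prod.mk.injEq, decide_eq_true_eq,
      decide_eq_false_iff_not] at h
    simp only [h, if_true, if_false] at hk
    linarith
  · rw [tb] at h
    simp only [closedType, hua, hub, huc, hud, false_or, Prod.mk.injEq, decide_eq_true_eq,
      decide_eq_false_iff_not] at h
    simp only [h, if_true, if_false] at hk
    apply mul_left_cancel₀ ha
    linarith
  · rw [tc] at h
    simp only [closedType, hua, hub, huc, hud, false_or, Prod.mk.injEq, decide_eq_true_eq,
      decide_eq_false_iff_not] at h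
    simp only [h, if_true, if_false] at hk
    apply mul_left_cancel₀ (mul_ne_zero ht hd)
    linarith
  · rw [td] at h
    simp only [closedType, hua, hub, huc, hud, false_or, Prod.mk.injEq, decide_eq_true_eq,
      decide_eq_false_iff_not] at h
    simp only [h, if_true, if_false] at hk
    apply mul_left_cancel₀ ht
    linarith

/-- Two vertices with the same closed neighbours on an induced path have the same column in
`A + μ D`; the entries in their own rows show that they are adjacent of scaled degree `1`. -/
theorem scaledDegree_eq_one (H : G.HasRankThree μ) (P : G.IsInducedPathFour a b c d)
    {u v : V} (huv : u ≠ v) (h : τ u = τ v) : s u = 1 := by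
  have entry : ∀ x, (x = a ∨ x = b ∨ x = c ∨ x = d) → ∀ w w', w ≠ w' → τ w = τ w' → B x w =
      if w = x ∨ G.Adj w x then 1 else 0 := by
    intro x hx w w' hne hw
    by_cases hwx : w = x
    · subst hwx
      simp only [true_or, if_true]
      exact (adjAddDegMatrix_self μ w).trans
        (H.scaledDegree_eq_one_of_mem P hx hne.symm hw.symm)
    · simp [adjAddDegMatrix, hwx, Ne.symm hwx, G.adj_comm x w]
  have h' := h
  simp only [closedType, Prod.mk.injEq, decide_eq_decide] at h'
  have col := H.column_eq P (u := u) (v := v)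
    (by rw [entry b (by simp) u v huv h, entry b (by simp) v u huv.symm h.symm]; simp only [h'.2.1])
    (by rw [entry c (by simp) u v huv h, entry c (by simp) v u huv.symm h.symm]
        simp only [h'.2.2.1])
    (by rw [entry d (by simp) u v huv h, entry d (by simp) v u huv.symm h.symm]
        simp only [h'.2.2.2]) u
  have hs : B u u = s u := adjAddDegMatrix_self μ u
  by_cases hadj : G.Adj u v
  · rw [← hs, col, adjAddDegMatrix_of_adj μ hadj]
  · rw [hs, adjAddDegMatrix_of_not_adj μ huv hadj] at col
    exact absurd col (H.scaledDegree_ne_zero P u)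

/-- A vertex of scaled degree other than `1` is alone in its class. -/
theorem closedTypeCard_eq_one (H : G.HasRankThree μ) (P : G.IsInducedPathFour a b c d)
    {u : V} {t : Bool × Bool × Bool × Bool} (hu : τ u = t) (hs : s u ≠ 1) :
    G.closedTypeCard a b c d t = 1 := by
  refine Finset.card_eq_one.2 ⟨u, Finset.eq_singleton_iff_unique_mem.2 ⟨by simpa using hu, ?_⟩⟩
  intro v hv
  by_contra hne
  exact hs (H.scaledDegree_eq_one P (Ne.symm hne) (hu.trans (Finset.mem_filter.1 hv).2.symm))

end HasRankThree

variable {a b c d : V}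

theorem closedTypeCard_pos {u : V} {t : Bool × Bool × Bool × Bool}
    (hu : G.closedType a b c d u = t) : 1 ≤ G.closedTypeCard a b c d t :=
  Finset.card_pos.2 ⟨u, by simpa using hu⟩

theorem closedTypeCard_eq_zero {t : Bool × Bool × Bool × Bool}
    (h : ∀ u, G.closedType a b c d u ≠ t) : G.closedTypeCard a b c d t = 0 := by
  simpa [closedTypeCard, Finset.card_eq_zero, Finset.filter_eq_empty_iff] using h

/-- The degree plus one is the size of the closed neighbourhood. -/
theorem degree_add_one (x : V) :
    G.degree x + 1 = (Finset.univ.filter fun u => u = x ∨ G.Adj u x).card := by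
  rw [← G.card_neighborFinset_eq_degree, ← Finset.card_insert_of_notMem (a := x) (by simp)]
  congr 1
  ext u
  simp [G.adj_comm]

theorem card_filter_closedType (p : Bool × Bool × Bool × Bool → Bool) :
    (Finset.univ.filter fun u => p (G.closedType a b c d u) = true).card =
      ∑ t, if p t then G.closedTypeCard a b c d t else 0 := by
  rw [Finset.card_eq_sum_card_fiberwise (f := G.closedType a b c d) (t := Finset.univ)
    (fun _ _ => by simp)]
  refine Finset.sum_congr rfl fun t _ => ?_
  split_ifs with h
  · rw [closedTypeCard, Finset.filter_filter]
    congr 1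
    ext u
    simp only [Finset.mem_filter, Finset.mem_univ, true_and, and_iff_right_iff_imp]
    rintro rfl; exact h
  · rw [Finset.card_eq_zero, Finset.filter_filter, Finset.filter_eq_empty_iff]
    rintro u _ ⟨h1, rfl⟩; exact h h1

end SimpleGraph

/-! ### Excluding all closed types but one -/

namespace SimpleGraph

variable {V : Type*} {G : SimpleGraph V} [Fintype V] [DecidableEq V] [DecidableRel G.Adj]

namespace HasRankThree

variable {μ : ℝ} {a b c d e f : V}

local notation "B" => adjAddDegMatrix G μ
local notation "s" => scaledDegree G μ
local notation "τ" => closedType G a b c d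
local notation "κ" => closedTypeCard G a b c d

/-- The closed types at an induced path are the vertex covers of the complementary path. -/
theorem closedType_cover (H : G.HasRankThree μ) (P : G.IsInducedPathFour a b c d) (u : V) :
    ((τ u).1 || (τ u).2.2.1) = true ∧ ((τ u).1 || (τ u).2.2.2) = true ∧
      ((τ u).2.1 || (τ u).2.2.2) = true := by
  have key : ∀ x y, x ≠ y → ¬ G.Adj x y → (u = x ∨ G.Adj u x) ∨ (u = y ∨ G.Adj u y) := by
    intro x y hne hxy
    by_contra! h
    rcases H.adj_of_ne u x y h.1.1 hne h.2.1 with h' | h' | h'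
    · exact h.1.2 h'
    · exact hxy h'
    · exact h.2.2 h'
  simp only [closedType, Bool.or_eq_true, decide_eq_true_eq]
  exact ⟨key a c P.ne_ac P.not_ac, key a d P.ne_ad P.not_ad, key b d P.ne_bd P.not_bd⟩

/-- Degrees on the path and the order of the graph as sums of class sizes; only the eight closed
types allowed by `closedType_cover` contribute. -/
theorem degree_and_card (H : G.HasRankThree μ) (P : G.IsInducedPathFour a b c d) :
    G.degree a + 1 = κ (true, true, false, false) + κ (true, true, true, false) +
      κ (true, false, false, true) + κ (true, true, false, true) + κ (true, false, true, true) +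
      κ (true, true, true, true) ∧
    G.degree b + 1 = κ (true, true, false, false) + κ (true, true, true, false) +
      κ (false, true, true, true) + κ (true, true, false, true) + κ (true, true, true, true) ∧
    G.degree c + 1 = κ (true, true, true, false) + κ (false, true, true, true) +
      κ (false, false, true, true) + κ (true, false, true, true) + κ (true, true, true, true) ∧
    G.degree d + 1 = κ (false, true, true, true) + κ (false, false, true, true) +
      κ (true, false, false, true) + κ (true, true, false, true) + κ (true, false, true, true) +
      κ (true, true, true, true) ∧
    Fintype.card V = κ (true, true, false, false) + κ (true, true, true, false) +
      κ (false, true, true, true) + κ (false, false, true, true) + κ (true, false, false, true) +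
      κ (true, true, false, true) + κ (true, false, true, true) + κ (true, true, true, true) := by
  have z : ∀ t : Bool × Bool × Bool × Bool, ¬ ((t.1 || t.2.2.1) = true ∧ (t.1 || t.2.2.2) = true ∧
      (t.2.1 || t.2.2.2) = true) → κ t = 0 := fun t ht =>
    closedTypeCard_eq_zero fun u hu => ht (hu ▸ H.closedType_cover P u)
  have z1 := z (false, false, false, false) (by simp)
  have z2 := z (false, false, false, true) (by simp)
  have z3 := z (false, false, true, false) (by simp)
  have z4 := z (false, true, false, false) (by simp)
  have z5 := z (true, false, false, false) (by simp)
  have z6 := z (false, true, false, true) (by simp)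
  have z7 := z (false, true, true, false) (by simp)
  have z8 := z (true, false, true, false) (by simp)
  have ha := card_filter_closedType (G := G) (a := a) (b := b) (c := c) (d := d) fun t => t.1
  have hb := card_filter_closedType (G := G) (a := a) (b := b) (c := c) (d := d) fun t => t.2.1
  have hc := card_filter_closedType (G := G) (a := a) (b := b) (c := c) (d := d) fun t => t.2.2.1
  have hd := card_filter_closedType (G := G) (a := a) (b := b) (c := c) (d := d) fun t => t.2.2.2
  have hn := card_filter_closedType (G := G) (a := a) (b := b) (c := c) (d := d) fun _ => true
  simp only [Fintype.sum_prod_type, Fintype.sum_bool, if_true, Bool.false_eq_true, if_false,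
    Finset.filter_true, Finset.card_univ, z1, z2, z3, z4, z5, z6, z7, z8] at ha hb hc hd hn
  simp only [closedType, decide_eq_true_eq] at ha hb hc hd
  rw [degree_add_one, degree_add_one, degree_add_one, degree_add_one, ha, hb, hc, hd]
  omega

/-- The kernel relation for the closed types of vertices adjacent to both ends of the path. -/
theorem exists_kernel_closedType (H : G.HasRankThree μ) (P : G.IsInducedPathFour a b c d) :
    ∃ t, t ≠ 0 ∧ 1 - s a * s b = s d * t ∧ t * (1 - s c * s d) = s a ∧ ∀ v,
      (τ v = (true, false, false, true) → 1 + t = 0) ∧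
      (τ v = (true, true, false, true) → 1 - s a + t = 0) ∧
      (τ v = (true, false, true, true) → 1 - s d * t + t = 0) ∧
      (τ v = (true, true, true, true) → 1 - s a - s d * t + t = 0) := by
  obtain ⟨-, -, t, ht, h1, h2, hk⟩ := H.exists_kernel P
  refine ⟨t, ht, h1, h2, fun v => ?_⟩
  by_cases hva : v = a
  · simp [hva, P.closedType_fst]
  by_cases hvb : v = b
  · simp [hvb, P.closedType_snd]
  by_cases hvc : v = c
  · simp [hvc, P.closedType_thd]
  by_cases hvd : v = d
  · simp [hvd, P.closedType_fth]
  have hk := hk v hva hvb hvc hvd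
  simp only [closedType, hva, hvb, hvc, hvd, false_or, Prod.mk.injEq, decide_eq_true_eq,
    decide_eq_false_iff_not]
  refine ⟨fun h => ?_, fun h => ?_, fun h => ?_, fun h => ?_⟩ <;>
    (simp only [h, if_true, if_false] at hk; linarith)

theorem card_eq_one_or (H : G.HasRankThree μ) (P : G.IsInducedPathFour a b c d)
    {u : V} {t : Bool × Bool × Bool × Bool} (hu : τ u = t) : κ t = 1 ∨ s u = 1 :=
  or_iff_not_imp_right.2 (H.closedTypeCard_eq_one P hu)

theorem scaledDegree_pos (H : G.HasRankThree μ) (hμ : 0 < μ) (v : V) : 0 < s v :=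
  mul_pos hμ (by exact_mod_cast H.degree_pos v)

theorem scaledDegree_neg (H : G.HasRankThree μ) (hμ : μ < 0) (v : V) : s v < 0 :=
  mul_neg_of_neg_of_pos hμ (by exact_mod_cast H.degree_pos v)

theorem pos_or_neg (H : G.HasRankThree μ) (P : G.IsInducedPathFour a b c d) : 0 < μ ∨ μ < 0 := by
  have h := H.scaledDegree_ne_zero P a
  rcases lt_trichotomy μ 0 with h' | rfl | h'
  · exact Or.inr h'
  · simp [scaledDegree] at h
  · exact Or.inl h'

/-- Vertices of the closed types `{a, b, d}` and `{a, c, d}` do not coexist: the kernel relations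
determine the signs of the scaled degrees inconsistently. -/
theorem not_closedType_abd_acd (H : G.HasRankThree μ) (P : G.IsInducedPathFour a b c d)
    (he : τ e = (true, true, false, true)) (hf : τ f = (true, false, true, true)) : False := by
  obtain ⟨t, -, h1, h2, hk⟩ := H.exists_kernel_closedType P
  have h3 := (hk e).2.1 he
  have h4 := (hk f).2.2.1 hf
  have h5 : t = s a - 1 := by linarith
  subst h5
  rcases H.pos_or_neg P with hμ | hμ
  · have pa := H.scaledDegree_pos hμ a
    have pb := H.scaledDegree_pos hμ b
    have pd := H.scaledDegree_pos hμ d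
    nlinarith [mul_pos pa pb, mul_pos pd pa, mul_pos pd (mul_pos pa pb)]
  · have pa := H.scaledDegree_neg hμ a
    have pd := H.scaledDegree_neg hμ d
    nlinarith [mul_pos_of_neg_of_neg pa pd]

/-- A vertex of closed type `{a, b, d}` does not occur. If `μ < 0`, no scaled degree is `1`, so `G`
is the house graph, whose kernel equations are inconsistent. If `μ > 0`, the kernel equations give
`s a < 1 < s b, s d`, which contradicts the degrees counted by class sizes. -/
theorem not_closedType_abd (H : G.HasRankThree μ) (P : G.IsInducedPathFour a b c d)
    (he : τ e = (true, true, false, true)) : False := by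
  obtain ⟨t, ht, h1, h2, hk⟩ := H.exists_kernel_closedType P
  have h3 := (hk e).2.1 he
  have za := H.scaledDegree_ne_zero P a
  have zd := H.scaledDegree_ne_zero P d
  have z1 : κ (true, false, true, true) = 0 :=
    closedTypeCard_eq_zero fun u hu => H.not_closedType_abd_acd P he hu
  have z2 : κ (true, false, false, true) = 0 :=
    closedTypeCard_eq_zero fun u hu => za (by linarith [(hk u).1 hu])
  have z3 : κ (true, true, true, true) = 0 :=
    closedTypeCard_eq_zero fun u hu =>
      mul_ne_zero zd ht (by linarith [(hk u).2.2.2 hu])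
  have ka := H.card_eq_one_or P P.closedType_fst
  have kb := H.card_eq_one_or P P.closedType_snd
  have kc := H.card_eq_one_or P P.closedType_thd
  have kd := H.card_eq_one_or P P.closedType_fth
  have ke := H.card_eq_one_or P he
  have pc := closedTypeCard_pos P.closedType_thd
  have pe := closedTypeCard_pos he
  obtain ⟨da, db, dc, dd, -⟩ := H.degree_and_card P
  simp only [z1, z2, z3] at da db dc dd
  generalize κ (true, true, false, false) = k₁ at *
  generalize κ (true, true, true, false) = k₂ at *
  generalize κ (false, true, true, true) = k₃ at *
  generalize κ (false, false, true, true) = k₄ at *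
  generalize κ (true, true, false, true) = k₅ at *
  have sa : s a = μ * G.degree a := rfl
  have sb : s b = μ * G.degree b := rfl
  have sc : s c = μ * G.degree c := rfl
  have sd : s d = μ * G.degree d := rfl
  obtain rfl : t = s a - 1 := by linarith
  have ka : k₁ = 1 := ka.resolve_right fun h => ht (by rw [h, sub_self])
  have mono : ∀ {x y : V}, 0 < μ → G.degree x ≤ G.degree y → s x ≤ s y := fun hμ h =>
    mul_le_mul_of_nonneg_left (by exact_mod_cast h) hμ.le
  rcases H.pos_or_neg P with hμ | hμ
  · have ppa := H.scaledDegree_pos hμ a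
    have ppb := H.scaledDegree_pos hμ b
    have ppc := H.scaledDegree_pos hμ c
    have ppd := H.scaledDegree_pos hμ d
    have hab : s a ≤ s b := mono hμ (by omega)
    have hlt : s a < 1 := by
      by_contra! hge
      have : 0 < s a - 1 := lt_of_le_of_ne (by linarith) (Ne.symm ht)
      nlinarith [mul_pos ppd this, mul_le_mul hge (hge.trans hab) zero_le_one ppa.le]
    have hb1 : 1 < s b := by
      have h4 : 0 < s d * (1 - s a) := mul_pos ppd (by linarith)
      have h5 : 1 < s a * s b := by linarith
      nlinarith
    have kb : k₂ = 1 := kb.resolve_right hb1.ne'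
    have hcd : s c ≤ s d := mono hμ (by omega)
    have hcd1 : 1 < s c * s d := by nlinarith
    have hd1 : 1 < s d := by nlinarith
    have kd : k₄ = 1 := kd.resolve_right hd1.ne'
    subst ka kb kd
    rcases kc with kc | kc
    · have : s d ≤ s a := mono hμ (by omega)
      linarith
    · have ea : (G.degree a : ℝ) = 1 + k₅ := by exact_mod_cast (by omega : G.degree a = 1 + k₅)
      have eb : (G.degree b : ℝ) = G.degree c + k₅ := by
        exact_mod_cast (by omega : G.degree b = G.degree c + k₅)
      have h6 : s d * (1 - s a) = 1 := by rw [kc] at h2; linarith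
      have h7 : s a * s b = 2 := by linarith
      have h8 : s b = 1 + μ * k₅ := by rw [sb, eb, ← kc, sc]; ring
      have h9 : s a = μ + μ * k₅ := by rw [sa, ea]; ring
      nlinarith
  · have nb := H.scaledDegree_neg hμ b
    have nc := H.scaledDegree_neg hμ c
    have nd := H.scaledDegree_neg hμ d
    have ne := H.scaledDegree_neg hμ e
    have kb : k₂ = 1 := kb.resolve_right (by linarith)
    have kc : k₃ = 1 := kc.resolve_right (by linarith)
    have kd : k₄ = 1 := kd.resolve_right (by linarith)
    have ke : k₅ = 1 := ke.resolve_right (by linarith)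
    subst ka kb kc kd ke
    have ea : s a = 2 * μ := by rw [sa, (by omega : G.degree a = 2)]; push_cast; ring
    have eb : s b = 3 * μ := by rw [sb, (by omega : G.degree b = 3)]; push_cast; ring
    have ec : s c = 2 * μ := by rw [sc, (by omega : G.degree c = 2)]; push_cast; ring
    have ed : s d = 2 * μ := by rw [sd, (by omega : G.degree d = 2)]; push_cast; ring
    rw [ea, eb, ed] at h1
    rw [ea, ec, ed] at h2
    nlinarith [sq_nonneg (μ), sq_nonneg (μ + 1 / 4)]

theorem not_closedType_acd (H : G.HasRankThree μ) (P : G.IsInducedPathFour a b c d)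
    (he : τ e = (true, false, true, true)) : False := by
  refine H.not_closedType_abd (e := e) P.reverse ?_
  simp only [closedType, Prod.mk.injEq] at he ⊢
  exact ⟨he.2.2.2, he.2.2.1, he.2.1, he.1⟩

/-- The scaled degree of a vertex adjacent to the whole path, in the case of a symmetric path. -/
theorem scaledDegree_mul_sq (H : G.HasRankThree μ) (P : G.IsInducedPathFour a b c d)
    (hf : τ f = (true, true, true, true)) (h1 : s d = s a) (h2 : s c = s b)
    (h3 : s a * s b = 1 + s a) : s f * s a ^ 2 = s a ^ 2 + 1 := by
  obtain ⟨-, -, -, -, fa, fb, fc, fd⟩ := P.dominating hf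
  have ebb : B b b = s b := adjAddDegMatrix_self μ b
  have ecc : B c c = s c := adjAddDegMatrix_self μ c
  have edd : B d d = s d := adjAddDegMatrix_self μ d
  have eff : B f f = s f := adjAddDegMatrix_self μ f
  have za := H.scaledDegree_ne_zero P a
  have hq : s b = (1 + s a) / s a := by field_simp; linarith
  -- The vector `(x, w, w, x, 1)` on `a, b, c, d, f` solving the equations of `b`, `c`, `d`.
  have key := H.combination_eq_zero P f (y₁ := - s b / (2 * s a)) (y₂ := -1 + s b / 2)
    (y₃ := -1 + s b / 2) (y₄ := - s b / (2 * s a)) (y₅ := 1)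
    (by rw [adjAddDegMatrix_of_adj μ P.ab.symm, ebb, adjAddDegMatrix_of_adj μ P.bc,
          adjAddDegMatrix_of_not_adj μ P.ne_bd P.not_bd, adjAddDegMatrix_of_adj μ fb.symm, hq]
        field_simp; ring)
    (by rw [adjAddDegMatrix_of_not_adj μ P.ne_ac.symm (mt G.adj_symm P.not_ac),
          adjAddDegMatrix_of_adj μ P.bc.symm, ecc, adjAddDegMatrix_of_adj μ P.cd,
          adjAddDegMatrix_of_adj μ fc.symm, h2, hq]
        field_simp; ring)
    (by rw [adjAddDegMatrix_of_not_adj μ P.ne_ad.symm (mt G.adj_symm P.not_ad),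
          adjAddDegMatrix_of_not_adj μ P.ne_bd.symm (mt G.adj_symm P.not_bd),
          adjAddDegMatrix_of_adj μ P.cd.symm, edd, adjAddDegMatrix_of_adj μ fd.symm, h1, hq]
        field_simp; ring) f
  rw [adjAddDegMatrix_of_adj μ fa, adjAddDegMatrix_of_adj μ fb, adjAddDegMatrix_of_adj μ fc,
    adjAddDegMatrix_of_adj μ fd, eff, hq] at key
  field_simp at key
  linear_combination key / 2

end HasRankThree

end SimpleGraph

namespace SimpleGraph

variable {V : Type*} {G : SimpleGraph V} [DecidableEq V] [DecidableRel G.Adj]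

variable [Fintype V]

theorem degree_eq_card_of_forall_adj {V : Type*} [Fintype V] {G : SimpleGraph V}
    [DecidableRel G.Adj] {x : V} {S : Finset V}
    (hS : ∀ y ∈ S, G.Adj x y) (hc : Fintype.card V = S.card + 1) : G.degree x = S.card := by
  apply le_antisymm
  · have := G.degree_lt_card_verts x
    omega
  · rw [← G.card_neighborFinset_eq_degree]
    exact Finset.card_le_card fun y hy => by simpa using hS y hy

namespace HasRankThree

variable {μ : ℝ} {a b c d e f : V}

local notation "B" => adjAddDegMatrix G μ
local notation "s" => scaledDegree G μ
local notation "τ" => closedType G a b c d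
local notation "κ" => closedTypeCard G a b c d

/-- The kernel vector `(1, -s a, s d, -1)` of a path that extends to an induced five-cycle. -/
theorem scaledDegree_mul_of_five_cycle (H : G.HasRankThree μ) (P : G.IsInducedPathFour a b c d)
    (he : τ e = (true, false, false, true)) : s a * s b = 1 + s d ∧ s c * s d = 1 + s a := by
  obtain ⟨t, -, h1, h2, hk⟩ := H.exists_kernel_closedType P
  obtain rfl : t = -1 := by linarith [(hk e).1 he]
  exact ⟨by linarith, by linarith⟩

/-- An induced five-cycle through the path excludes vertices adjacent to the whole path: such a
vertex would be the hub of a wheel, and `G` would be that wheel. -/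
theorem not_closedType_ad_abcd (H : G.HasRankThree μ) (P : G.IsInducedPathFour a b c d)
    (he : τ e = (true, false, false, true)) (hf : τ f = (true, true, true, true)) : False := by
  have za := H.scaledDegree_ne_zero P a
  obtain ⟨r1, r2⟩ := H.scaledDegree_mul_of_five_cycle P he
  have h41 : s d = s a := by
    obtain ⟨t, -, -, -, hk⟩ := H.exists_kernel_closedType P
    obtain rfl : t = -1 := by linarith [(hk e).1 he]
    linarith [(hk f).2.2.2 hf]
  have h32 : s c = s b := by
    apply mul_right_cancel₀ za
    rw [h41] at r1 r2
    linarith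
  have hab : s a * s b = 1 + s a := by rw [r1, h41]
  have hff := H.scaledDegree_mul_sq P hf h41 h32 hab
  obtain ⟨fa', fb', fc', fd', fa, fb, fc, fd⟩ := P.dominating hf
  obtain ⟨ea, eb, ec, ed, eb', ec'⟩ := P.five_cycle he
  obtain ⟨P', ha'⟩ := P.rotate he
  have hfe' : f ≠ e := by rintro rfl; exact eb fb
  by_cases hfe : G.Adj f e
  · have hf' : G.closedType b c d e f = (true, true, true, true) := by
      simp [closedType, fb, fc, fd, hfe]
    have hbe : s b = s e := by
      obtain ⟨t, -, -, -, hk⟩ := H.exists_kernel_closedType P'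
      obtain rfl : t = -1 := by linarith [(hk a).1 ha']
      linarith [(hk f).2.2.2 hf']
    have r3 := (H.scaledDegree_mul_of_five_cycle P' ha').1
    rw [h32, ← hbe] at r3
    have hb1 : s b ≠ 1 := by
      intro h; rw [h] at r3; norm_num at r3
    have heq : s a = s b := by
      apply mul_right_cancel₀ (sub_ne_zero.2 hb1)
      linarith
    have hf1 : s f ≠ 1 := by
      intro h; rw [h] at hff; linarith
    have ka := H.closedTypeCard_eq_one P P.closedType_fst (heq ▸ hb1)
    have kb := H.closedTypeCard_eq_one P P.closedType_snd hb1
    have kc := H.closedTypeCard_eq_one P P.closedType_thd (h32 ▸ hb1)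
    have kd := H.closedTypeCard_eq_one P P.closedType_fth (h41 ▸ heq ▸ hb1)
    have ke := H.closedTypeCard_eq_one P he (hbe ▸ hb1)
    have kf := H.closedTypeCard_eq_one P hf hf1
    have z1 : κ (true, true, false, true) = 0 :=
      closedTypeCard_eq_zero fun u hu => H.not_closedType_abd P hu
    have z2 : κ (true, false, true, true) = 0 :=
      closedTypeCard_eq_zero fun u hu => H.not_closedType_acd P hu
    obtain ⟨da, -, -, -, hn⟩ := H.degree_and_card P
    simp only [ka, kb, kc, kd, ke, kf, z1, z2] at da hn
    have hc5 : ({a, b, c, d, e} : Finset V).card = 5 := by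
      rw [Finset.card_insert_of_notMem, Finset.card_insert_of_notMem,
        Finset.card_insert_of_notMem, Finset.card_insert_of_notMem, Finset.card_singleton] <;>
      simp [P.ab.ne, P.bc.ne, P.cd.ne, P.ne_ac, P.ne_ad, P.ne_bd, ea.ne', ed.ne', eb'.symm,
        ec'.symm]
    have df : G.degree f = 5 := by
      rw [← hc5]
      exact degree_eq_card_of_forall_adj (by simp [fa, fb, fc, fd, hfe]) (by omega)
    have sa : s a = 3 * μ := by
      rw [scaledDegree, (by omega : G.degree a = 3)]; push_cast; ring
    have sf : s f = 5 * μ := by rw [scaledDegree, df]; push_cast; ring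
    rw [← heq] at hab
    rw [sf] at hff
    rw [sa] at hff hab
    -- Reduce the cubic `hff` modulo the quadratic `hab`.
    have h21 : 21 * μ = 1 := by linear_combination 3 * hff - (15 * μ + 2) * hab
    nlinarith
  · have hf' : G.closedType b c d e f = G.closedType b c d e c := by
      rw [P'.closedType_snd]
      simp [closedType, fb, fc, fd, hfe, hfe']
    have hc1 := H.scaledDegree_eq_one_of_mem P' (x := c) (by simp) fc' hf'
    rw [← h32, hc1] at hab
    linarith

/-- A vertex adjacent to the whole path does not occur. The kernel equations either give
`s a = s d = 1`, which makes `deg a = 1`, or `s a = s d`, `s b = s c` and all classes of size one;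
then `G` is the gem graph, where the degrees are inconsistent with `scaledDegree_mul_sq`. -/
theorem not_closedType_abcd (H : G.HasRankThree μ) (P : G.IsInducedPathFour a b c d)
    (hf : τ f = (true, true, true, true)) : False := by
  have z1 : κ (true, true, false, true) = 0 :=
    closedTypeCard_eq_zero fun u hu => H.not_closedType_abd P hu
  have z2 : κ (true, false, true, true) = 0 :=
    closedTypeCard_eq_zero fun u hu => H.not_closedType_acd P hu
  have z3 : κ (true, false, false, true) = 0 :=
    closedTypeCard_eq_zero fun u hu => H.not_closedType_ad_abcd P hu hf
  obtain ⟨t, ht, h1, h2, hk⟩ := H.exists_kernel_closedType P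
  have h3 := (hk f).2.2.2 hf
  have ka := H.card_eq_one_or P P.closedType_fst
  have kb := H.card_eq_one_or P P.closedType_snd
  have kc := H.card_eq_one_or P P.closedType_thd
  have kd := H.card_eq_one_or P P.closedType_fth
  have pa := closedTypeCard_pos P.closedType_fst
  have pb := closedTypeCard_pos P.closedType_snd
  have pc := closedTypeCard_pos P.closedType_thd
  have pf := closedTypeCard_pos hf
  have kf := fun h => H.closedTypeCard_eq_one P hf h
  obtain ⟨da, db, dc, dd, hn⟩ := H.degree_and_card P
  simp only [z1, z2, z3] at da db dc dd hn
  generalize κ (true, true, false, false) = k₁ at *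
  generalize κ (true, true, true, false) = k₂ at *
  generalize κ (false, true, true, true) = k₃ at *
  generalize κ (false, false, true, true) = k₄ at *
  generalize κ (true, true, true, true) = k₅ at *
  have za := H.scaledDegree_ne_zero P a
  have zb := H.scaledDegree_ne_zero P b
  have sa : s a = μ * G.degree a := rfl
  have sb : s b = μ * G.degree b := rfl
  have sc : s c = μ * G.degree c := rfl
  have sd : s d = μ * G.degree d := rfl
  by_cases ha1 : s a = 1
  · have hd1 : s d = 1 := by
      apply mul_right_cancel₀ ht
      linarith
    have hμ : 0 < μ := by
      have : (0 : ℝ) < G.degree a := by exact_mod_cast H.degree_pos a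
      by_contra! h
      nlinarith
    have eb : s b = 1 + μ * k₃ := by
      rw [sb, (by omega : G.degree b = G.degree a + k₃), ← ha1, sa]; push_cast; ring
    have ec : s c = 1 + μ * k₂ := by
      rw [sc, (by omega : G.degree c = G.degree d + k₂), ← hd1, sd]; push_cast; ring
    have q2 : 0 < μ * k₂ := mul_pos hμ (by exact_mod_cast pb)
    have q3 : 0 < μ * k₃ := mul_pos hμ (by exact_mod_cast pc)
    have kb : k₂ = 1 := kb.resolve_right (by linarith)
    have kc : k₃ = 1 := kc.resolve_right (by linarith)
    rw [kc] at eb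
    rw [kb] at ec
    rw [ha1, hd1, eb] at h1
    rw [ha1, hd1, ec] at h2
    obtain rfl : t = -μ := by push_cast at h1; linarith
    have hμ1 : μ = 1 := by push_cast at h2; nlinarith
    have hda : μ * G.degree a = 1 := sa.symm.trans ha1
    rw [hμ1, one_mul] at hda
    have : G.degree a = 1 := by exact_mod_cast hda
    omega
  · have hd1 : s d ≠ 1 := by
      intro h
      rw [h] at h3
      exact ha1 (by linarith)
    have ka : k₁ = 1 := ka.resolve_right ha1
    have kd : k₄ = 1 := kd.resolve_right hd1
    have hcb : s c = s b := by
      rw [sb, sc, (by omega : G.degree c = G.degree b)]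
    have ht' : t * (1 - s d) = s a - 1 := by linarith
    -- Multiply the two kernel equations by `1 - s d` to eliminate `t`.
    have i1 : (1 - s a * s b) * (1 - s d) = s d * (s a - 1) := by
      linear_combination (1 - s d) * h1 + s d * ht'
    have i2 : (s a - 1) * (1 - s b * s d) = s a * (1 - s d) := by
      rw [hcb] at h2
      linear_combination (1 - s d) * h2 - (1 - s b * s d) * ht'
    have hda : s d = s a := by
      apply mul_left_cancel₀ zb
      linear_combination i1 + i2
    have hab : s a * s b = 1 + s a := by
      apply mul_left_cancel₀ (sub_ne_zero.2 ha1)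
      rw [hda] at i1
      linear_combination i1
    have hff := H.scaledDegree_mul_sq P hf hda hcb hab
    have hb1 : s b ≠ 1 := by
      intro h; rw [h] at hab; linarith
    have kb : k₂ = 1 := kb.resolve_right hb1
    have kc : k₃ = 1 := kc.resolve_right (hcb ▸ hb1)
    have kf : k₅ = 1 := kf fun h => by rw [h] at hff; linarith
    obtain ⟨fa', fb', fc', fd', fa, fb, fc, fd⟩ := P.dominating hf
    have hc4 : ({a, b, c, d} : Finset V).card = 4 := by
      rw [Finset.card_insert_of_notMem, Finset.card_insert_of_notMem,
        Finset.card_insert_of_notMem, Finset.card_singleton] <;>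
      simp [P.ab.ne, P.bc.ne, P.cd.ne, P.ne_ac, P.ne_ad, P.ne_bd]
    have df : G.degree f = 4 := by
      rw [← hc4]
      exact degree_eq_card_of_forall_adj (by simp [fa, fb, fc, fd]) (by omega)
    have ea : s a = 2 * μ := by rw [sa, (by omega : G.degree a = 2)]; push_cast; ring
    have eb : s b = 3 * μ := by rw [sb, (by omega : G.degree b = 3)]; push_cast; ring
    have ef : s f = 4 * μ := by rw [scaledDegree, df]; push_cast; ring
    rw [ef] at hff
    rw [ea] at hff hab
    rw [eb] at hab
    -- Reduce the cubic `hff` modulo the quadratic `hab`.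
    have h4 : 4 * μ = 1 := by linear_combination (9 / 7) * hff - ((24 * μ + 2) / 7) * hab
    nlinarith

/-- No vertex of an induced five-cycle has scaled degree `1`; by rotation it suffices to treat
`e`. -/
theorem scaledDegree_ne_one_of_five_cycle (H : G.HasRankThree μ)
    (P : G.IsInducedPathFour a b c d) (he : τ e = (true, false, false, true)) : s e ≠ 1 := by
  intro h
  obtain ⟨P₁, h₁⟩ := P.rotate he
  obtain ⟨P₂, h₂⟩ := P₁.rotate h₁
  have r1 := (H.scaledDegree_mul_of_five_cycle P₁ h₁).1
  have r2 := (H.scaledDegree_mul_of_five_cycle P₁ h₁).2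
  have r3 := (H.scaledDegree_mul_of_five_cycle P₂ h₂).2
  have ha1 : s a ≠ 1 := fun h' => H.scaledDegree_ne_zero P c (by
    rw [h, h'] at r3; linarith)
  have hd1 : s d ≠ 1 := fun h' => H.scaledDegree_ne_zero P b (by
    rw [h, h'] at r2; linarith)
  have ka := H.closedTypeCard_eq_one P P.closedType_fst ha1
  have kd := H.closedTypeCard_eq_one P P.closedType_fth hd1
  have z1 : κ (true, true, false, true) = 0 :=
    closedTypeCard_eq_zero fun u hu => H.not_closedType_abd P hu
  have z2 : κ (true, false, true, true) = 0 :=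
    closedTypeCard_eq_zero fun u hu => H.not_closedType_acd P hu
  have z3 : κ (true, true, true, true) = 0 :=
    closedTypeCard_eq_zero fun u hu => H.not_closedType_abcd P hu
  obtain ⟨-, db, dc, -, -⟩ := H.degree_and_card P
  simp only [z1, z2, z3, ka, kd] at db dc
  -- Now `s b = s c` and `s b * s c = 2`, while `s b = deg b / deg e` is rational.
  have hbc : s c = s b := by
    rw [scaledDegree, scaledDegree, (by omega : G.degree c = G.degree b)]
  rw [h, hbc] at r1
  have hμ : μ = 1 / G.degree e := by
    have : (G.degree e : ℝ) ≠ 0 := by exact_mod_cast (H.degree_pos e).ne'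
    field_simp
    exact h
  refine irrational_sqrt_two.ne_rational (G.degree b) (G.degree e) ?_
  have h4 : s b = (G.degree b : ℝ) / G.degree e := by rw [scaledDegree, hμ]; ring
  push_cast
  rw [← h4, Real.sqrt_eq_iff_mul_self_eq (by norm_num) (by rw [h4]; positivity)]
  linarith

theorem nonempty_iso_cycleGraph_five (H : G.HasRankThree μ)
    (P : G.IsInducedPathFour a b c d) (he : τ e = (true, false, false, true)) :
    Nonempty (G ≃g cycleGraph 5) := by
  obtain ⟨P₁, h₁⟩ := P.rotate he
  obtain ⟨P₂, h₂⟩ := P₁.rotate h₁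
  obtain ⟨P₃, h₃⟩ := P₂.rotate h₂
  -- Every vertex of the five-cycle is the last one of some rotation.
  obtain ⟨P₄, h₄⟩ := P₃.rotate h₃
  have ke := H.closedTypeCard_eq_one P he (H.scaledDegree_ne_one_of_five_cycle P he)
  have ka := H.closedTypeCard_eq_one P P.closedType_fst (H.scaledDegree_ne_one_of_five_cycle P₁ h₁)
  have kb := H.closedTypeCard_eq_one P P.closedType_snd (H.scaledDegree_ne_one_of_five_cycle P₂ h₂)
  have kc := H.closedTypeCard_eq_one P P.closedType_thd (H.scaledDegree_ne_one_of_five_cycle P₃ h₃)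
  have kd := H.closedTypeCard_eq_one P P.closedType_fth (H.scaledDegree_ne_one_of_five_cycle P₄ h₄)
  have z1 : κ (true, true, false, true) = 0 :=
    closedTypeCard_eq_zero fun u hu => H.not_closedType_abd P hu
  have z2 : κ (true, false, true, true) = 0 :=
    closedTypeCard_eq_zero fun u hu => H.not_closedType_acd P hu
  have z3 : κ (true, true, true, true) = 0 :=
    closedTypeCard_eq_zero fun u hu => H.not_closedType_abcd P hu
  have hn := (H.degree_and_card P).2.2.2.2
  simp only [z1, z2, z3, ka, kb, kc, kd, ke] at hn
  obtain ⟨ea, eb, ec, ed, eb', ec'⟩ := P.five_cycle he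
  have hinj : Function.Injective ![a, b, c, d, e] := by
    intro i j
    fin_cases i <;> fin_cases j <;>
      simp [P.ab.ne, P.bc.ne, P.cd.ne, P.ne_ac, P.ne_ad, P.ne_bd, ea.ne', ed.ne', eb'.symm,
        ec'.symm, P.ab.ne', P.bc.ne', P.cd.ne', P.ne_ac.symm, P.ne_ad.symm, P.ne_bd.symm, ea.ne,
        ed.ne, eb', ec']
  have hbij : Function.Bijective ![a, b, c, d, e] :=
    (Fintype.bijective_iff_injective_and_card _).2 ⟨hinj, by simp [hn]⟩
  have hadj : ∀ i j, G.Adj (![a, b, c, d, e] i) (![a, b, c, d, e] j) ↔ (cycleGraph 5).Adj i j := by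
    intro i j
    fin_cases i <;> fin_cases j <;>
      simp [cycleGraph_adj, P.ab, P.bc, P.cd, P.not_ac, P.not_ad, P.not_bd, ea, eb, ec, ed,
        P.ab.symm, P.bc.symm, P.cd.symm, mt G.adj_symm P.not_ac, mt G.adj_symm P.not_ad,
        mt G.adj_symm P.not_bd, ea.symm, mt G.adj_symm eb, mt G.adj_symm ec, ed.symm] <;> decide
  exact ⟨(⟨Equiv.ofBijective _ hbij, fun {i j} => hadj i j⟩ : cycleGraph 5 ≃g G).symm⟩

/-- With diameter two the ends of an induced path have a common neighbour, and its closed type can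
only be the one that closes the path to a five-cycle. -/
theorem nonempty_iso_of_common_neighbor (H : G.HasRankThree μ)
    (P : G.IsInducedPathFour a b c d) (ha : G.Adj e a) (hd : G.Adj e d) :
    Nonempty (G ≃g cycleGraph 5) := by
  rcases hb : decide (e = b ∨ G.Adj e b) with _ | _ <;>
    rcases hc : decide (e = c ∨ G.Adj e c) with _ | _
  · exact H.nonempty_iso_cycleGraph_five (e := e) P
      (by simp only [closedType, ha, hd, hb, hc]; simp)
  · exact (H.not_closedType_acd (e := e) P (by simp only [closedType, ha, hd, hb, hc]; simp)).elim
  · exact (H.not_closedType_abd (e := e) P (by simp only [closedType, ha, hd, hb, hc]; simp)).elim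
  · exact (H.not_closedType_abcd (f := e) P (by simp only [closedType, ha, hd, hb, hc]; simp)).elim

end HasRankThree

end SimpleGraph

/-! ### The five-cycle and the equivalence -/

namespace SimpleGraph

variable {V : Type*} {G : SimpleGraph V}

theorem IsInducedPathFour.of_embedding (φ : pathGraph 4 ↪g G) :
    G.IsInducedPathFour (φ 0) (φ 1) (φ 2) (φ 3) where
  ab := φ.map_adj_iff.2 (by simp [pathGraph_adj])
  bc := φ.map_adj_iff.2 (by simp [pathGraph_adj])
  cd := φ.map_adj_iff.2 (by simp [pathGraph_adj])
  not_ac := fun h => by simpa [pathGraph_adj] using φ.map_adj_iff.1 h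
  not_ad := fun h => by simpa [pathGraph_adj] using φ.map_adj_iff.1 h
  not_bd := fun h => by simpa [pathGraph_adj] using φ.map_adj_iff.1 h

theorem exists_common_neighbor_of_diam_eq_two (h : G.diam = 2)
    {u v : V} (hne : u ≠ v) (hadj : ¬ G.Adj u v) : ∃ w, G.Adj w u ∧ G.Adj w v := by
  have htop : G.ediam ≠ ⊤ := ediam_ne_top_of_diam_ne_zero (by omega)
  have hle : G.edist u v ≤ 2 := by
    refine edist_le_ediam.trans ?_
    rw [← ENat.natCast_toNat htop]
    exact_mod_cast h.le
  obtain ⟨w, hw⟩ : (G.commonNeighbors u v).Nonempty := by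
    rw [Set.nonempty_iff_ne_empty]
    exact fun he => absurd (two_lt_edist_iff.2 ⟨hne, hadj, he⟩) (not_lt.2 hle)
  rw [mem_commonNeighbors] at hw
  exact ⟨w, hw.1.symm, hw.2.symm⟩

theorem diam_eq_two_of_iso (φ : G ≃g cycleGraph 5) : G.diam = 2 := by
  have hle : G.ediam ≤ 2 := by
    refine ediam_le_of_edist_le fun u v => not_lt.1 fun h => ?_
    obtain ⟨hne, hadj, hc⟩ := two_lt_edist_iff.1 h
    have key : ∀ i j : Fin 5, i ≠ j → ¬ (cycleGraph 5).Adj i j →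
        ∃ k, (cycleGraph 5).Adj i k ∧ (cycleGraph 5).Adj j k := by decide
    obtain ⟨k, h1, h2⟩ := key (φ u) (φ v) (φ.injective.ne hne) (mt φ.map_adj_iff.1 hadj)
    rw [← φ.apply_symm_apply k] at h1 h2
    exact hc.le (G.mem_commonNeighbors.2 ⟨φ.map_adj_iff.1 h1, φ.map_adj_iff.1 h2⟩)
  have hge : 2 ≤ G.ediam := by
    have h : G.edist (φ.symm 0) (φ.symm 2) = 2 :=
      edist_eq_two_iff.2 ⟨by simp, by rw [φ.symm.map_adj_iff]; decide, φ.symm 1,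
        G.mem_commonNeighbors.2 ⟨by rw [φ.symm.map_adj_iff]; decide,
          by rw [φ.symm.map_adj_iff]; decide⟩⟩
    exact h ▸ edist_le_ediam
  rw [diam, le_antisymm hle hge]
  rfl

variable [Fintype V]

theorem adj_of_indepNum_eq_two (h : G.indepNum = 2) (u v w : V) (huv : u ≠ v) (hvw : v ≠ w)
    (huw : u ≠ w) : G.Adj u v ∨ G.Adj v w ∨ G.Adj u w := by
  classical
  by_contra! hn
  have hi : G.IsIndepSet (({u, v, w} : Finset V) : Set V) := by
    intro x hx y hy hxy
    simp only [Finset.coe_insert, Finset.coe_singleton, Set.mem_insert_iff,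
      Set.mem_singleton_iff] at hx hy
    rcases hx with rfl | rfl | rfl <;> rcases hy with rfl | rfl | rfl <;>
      simp_all [G.adj_comm]
  have := hi.card_le_indepNum
  rw [Finset.card_eq_three.2 ⟨u, v, w, huv, huw, hvw, rfl⟩] at this
  omega

theorem indepNum_eq_two_of_iso (φ : G ≃g cycleGraph 5) : G.indepNum = 2 := by
  classical
  apply le_antisymm
  · obtain ⟨t, ht⟩ := G.exists_isNIndepSet_indepNum
    have h5 : ∀ t : Finset (Fin 5), (∀ x ∈ t, ∀ y ∈ t, ¬ (cycleGraph 5).Adj x y) → t.card ≤ 2 := by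
      decide
    rw [← ht.card_eq, ← Finset.card_map φ.toEquiv.toEmbedding]
    apply h5
    simp only [Finset.mem_map, forall_exists_index, and_imp]
    rintro _ x hx rfl _ y hy rfl hxy
    have hxy : G.Adj x y := φ.map_adj_iff.1 hxy
    exact ht.isIndepSet hx hy hxy.ne hxy
  · have hi : G.IsIndepSet (({φ.symm 0, φ.symm 2} : Finset V) : Set V) := by
      have h02 : ¬ (cycleGraph 5).Adj 0 2 := by decide
      have h20 : ¬ (cycleGraph 5).Adj 2 0 := by decide
      intro x hx y hy hxy
      simp only [Finset.coe_insert, Finset.coe_singleton, Set.mem_insert_iff,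
        Set.mem_singleton_iff] at hx hy
      rcases hx with rfl | rfl <;> rcases hy with rfl | rfl <;>
        simp_all [φ.symm.map_adj_iff]
    have := hi.card_le_indepNum
    rwa [Finset.card_pair (by simp)] at this

variable [DecidableEq V] [DecidableRel G.Adj]

/-- The adjacency matrix of the five-cycle is invertible, so `1` is not an eigenvalue of the
normalized Laplacian. -/
theorem normLapEigenvalue_ne_one_of_iso (φ : G ≃g cycleGraph 5) (i : ℕ) (h1 : 1 ≤ i)
    (h2 : i ≤ Fintype.card V) : G.normLapEigenvalue i h1 h2 ≠ 1 := by
  intro h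
  set j : V := Fintype.equivOfCardEq (Fintype.card_fin _)
    (⟨i - 1, by omega⟩ : Fin (Fintype.card V)) with hj
  have hev : G.isHermitian_normLapMatrix.eigenvalues j = 1 := by
    rw [Matrix.IsHermitian.eigenvalues, hj, Equiv.symm_apply_apply]
    exact h
  have hvec := G.isHermitian_normLapMatrix.mulVec_eigenvectorBasis j
  rw [hev, one_smul] at hvec
  have hx0 := G.isHermitian_normLapMatrix.eigenvectorBasis.toBasis.ne_zero j
  rw [OrthonormalBasis.coe_toBasis] at hx0
  set x := G.isHermitian_normLapMatrix.eigenvectorBasis j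
  apply hx0
  have hdeg : ∀ v, G.degree v = 2 := by
    intro v
    rw [← φ.degree_eq v]
    generalize φ v = k
    revert k
    decide
  have hrow : ∀ k, ∑ l, (if (cycleGraph 5).Adj k l then x (φ.symm l) else 0) = 0 := by
    intro k
    have hk := congrFun hvec (φ.symm k)
    rw [Matrix.mulVec, dotProduct, ← φ.symm.toEquiv.sum_comp] at hk
    -- The graph is 2-regular, so the off-diagonal entries are `-1 / 2` on edges.
    have hterm : ∀ l, G.normLapMatrix (φ.symm k) (φ.symm l) * x (φ.symm l) =
        (if k = l then x (φ.symm l) else 0) -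
          (1 / 2) * (if (cycleGraph 5).Adj k l then x (φ.symm l) else 0) := by
      intro l
      have h4 : Real.sqrt ((2 : ℝ) * 2) = 2 := Real.sqrt_mul_self (by norm_num)
      by_cases hkl : k = l
      · subst hkl
        simp [normLapMatrix]
      · by_cases ha : (cycleGraph 5).Adj k l
        · simp [normLapMatrix, hkl, ha, φ.symm.map_adj_iff, hdeg, h4]
          ring
        · simp [normLapMatrix, hkl, ha, φ.symm.map_adj_iff]
    have hk' : ∑ l, G.normLapMatrix (φ.symm k) (φ.symm l) * x (φ.symm l) = x (φ.symm k) := hk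
    rw [Finset.sum_congr rfl fun l _ => hterm l, Finset.sum_sub_distrib, ← Finset.mul_sum,
      Finset.sum_ite_eq, if_pos (Finset.mem_univ _)] at hk'
    linarith
  have r0 := hrow 0
  have r1 := hrow 1
  have r2 := hrow 2
  have r3 := hrow 3
  have r4 := hrow 4
  simp +decide [Fin.sum_univ_five] at r0 r1 r2 r3 r4
  have hz : ∀ k, x (φ.symm k) = 0 := by
    have z0 : x (φ.symm 0) = 0 := by linarith
    have z1 : x (φ.symm 1) = 0 := by linarith
    have z2 : x (φ.symm 2) = 0 := by linarith
    have z3 : x (φ.symm 3) = 0 := by linarith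
    have z4 : x (φ.symm 4) = 0 := by linarith
    intro k
    fin_cases k
    exacts [z0, z1, z2, z3, z4]
  ext v
  rw [← φ.symm_apply_apply v, hz]
  rfl

end SimpleGraph

theorem theorem1p2 {V : Type*} [Fintype V] [DecidableEq V] (G : SimpleGraph V)
    [DecidableRel G.Adj] (hn : 5 ≤ Fintype.card V) (hG : G.MemGnSubThree) :
    ((SimpleGraph.pathGraph 4).IsIndContained G ∧
        G.normLapEigenvalue (Fintype.card V - 1) (by omega) (by omega) ≠ 1 ∧
        G.indepNum = 2 ∧ G.diam = 2) ↔
      Nonempty (G ≃g SimpleGraph.cycleGraph 5) := by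
  constructor
  · rintro ⟨⟨φ⟩, -, hα, hdiam⟩
    obtain ⟨θ, hθ⟩ := hG.exists_multiplicity
    have : Nontrivial V := Fintype.one_lt_card_iff_nontrivial.1 (by omega)
    have hdeg : ∀ v, 0 < G.degree v := fun v => hG.connected.preconnected.degree_pos_of_nontrivial v
    have H : G.HasRankThree (θ - 1) :=
      ⟨SimpleGraph.rank_adjAddDegMatrix hdeg (by omega), hdeg,
        SimpleGraph.adj_of_indepNum_eq_two hα⟩
    have P := SimpleGraph.IsInducedPathFour.of_embedding φ
    obtain ⟨w, ha, hd⟩ :=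
      SimpleGraph.exists_common_neighbor_of_diam_eq_two hdiam P.ne_ad P.not_ad
    exact H.nonempty_iso_of_common_neighbor P ha hd
  · rintro ⟨φ⟩
    refine ⟨?_, SimpleGraph.normLapEigenvalue_ne_one_of_iso φ _ _ _,
      SimpleGraph.indepNum_eq_two_of_iso φ, SimpleGraph.diam_eq_two_of_iso φ⟩
    let ψ : SimpleGraph.pathGraph 4 ↪g SimpleGraph.cycleGraph 5 :=
      ⟨Fin.castSuccEmb, by intro i j; revert i j; simp only [SimpleGraph.pathGraph_adj]; decide⟩
    exact ⟨φ.symm.toEmbedding.comp ψ⟩
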